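/- **Proposition.** Let $n\ge 0$, let $W$ be a real vector space of dimension $n+1$, let $\mathbb P_n=(W\setminus\{0\})/\mathbb R^{\times}$ be its projective space (a smooth manifold with the quotient topology and the affine charts $(x^0:\dots:x^n)\mapsto(x^1/x^0,\dots,x^n/x^0)$), and fix a point $A\in\mathbb P_n$. A projective transformation of $\mathbb P_n$ is a map $[v]\mapsto[u v]$ with $u\in GL(W)$; let $G$ be the stabilizer of $A$ in the group of all projective transformations. The group of projective transformations carries the quotient topology of $GL(W)$, and $G$ is a Lie group with the subspace topology and with the following global charts: in linear coordinates $(x^0,x)\in\mathbb R\times\mathbb R^n$ on $W$ in which $A=(1:0:\dots:0)$, an element $f\in G$ is sent to the unique pair $(\alpha,T)$, with $\alpha$ a linear form on $\mathbb R^n$ and $T\in GL(\mathbb R^n)$, such that $f$ is induced by $(x^0,x)\mapsto(x^0+\alpha x,\,Tx)$. Put $V=T_A\mathbb P_n$ and let $GL(V)$ be the Lie group of invertible linear operators of $V$. For $f\in G$ let $d_Af\colon V\to V$ be the differential of $f$ at $A=f(A)$. Then: 1. Every $f\in G$ is differentiable at $A$ with $d_Af\in GL(V)$, and the linearizing map $\beta\colon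 G\to GL(V)$, $f\mapsto d_Af$, is a surjective homomorphism of Lie groups (a smooth, surjective group homomorphism). 2. The kernel $H=\ker\beta$ is a closed normal subgroup of $G$. 3. The map $\bar\beta\colon G/H\to GL(V)$, $fH\mapsto d_Af$, is well defined and is an isomorphism of Lie groups, where $G/H$ is the quotient Lie group. That is: $\bar\beta$ is a group isomorphism; the topological group $G/H$ admits a smooth structure that makes it a Lie group and the projection $G\to G/H$ a smooth submersion; and for every such structure, modelled on a normed real vector space, both $\bar\beta$ and $\bar\beta^{-1}$ are smooth. -/

import Mathlib

open scoped Manifold ContDiff Topology LinearAlgebra.Projectivization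

noncomputable section

namespace CenteredProjective

/-- The coordinate space `ℝⁿ`. -/
abbrev E (n : ℕ) : Type := EuclideanSpace ℝ (Fin n)

/-! ### The projective space as a topological space and as a manifold -/

section ProjectiveSpace

variable {W : Type*} [NormedAddCommGroup W] [NormedSpace ℝ W]

/-- The quotient topology of `W ∖ {0}` modulo collinearity. -/
instance : TopologicalSpace (ℙ ℝ W) :=
  inferInstanceAs (TopologicalSpace (Quotient (projectivizationSetoid ℝ W)))

theorem isQuotientMap_mk' :
    Topology.IsQuotientMap (Projectivization.mk' ℝ : {v : W // v ≠ 0} → ℙ ℝ W) :=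
  isQuotientMap_quot_mk

theorem symm_one_ne_zero {n : ℕ} (φ : W ≃L[ℝ] ℝ × E n) (X : E n) : φ.symm (1, X) ≠ 0 := by
  simp

/-- The affine chart of the projective space given by linear coordinates
`φ = (x⁰, (x¹, …, xⁿ))` on `W` (that is, by a basis of `W`): it is defined on `{x⁰ ≠ 0}` and
sends `(x⁰ : x¹ : … : xⁿ)` to `(x¹/x⁰, …, xⁿ/x⁰)`. -/
def affineChart {n : ℕ} (φ : W ≃L[ℝ] ℝ × E n) : OpenPartialHomeomorph (ℙ ℝ W) (E n) where
  toFun := Projectivization.lift (fun v => (φ v.1).1⁻¹ • (φ v.1).2) (by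
    rintro ⟨a, ha⟩ ⟨b, hb⟩ t (rfl : a = t • b)
    have ht : t ≠ 0 := by rintro rfl; simp at ha
    simp [smul_smul, ht])
  invFun X := Projectivization.mk ℝ (φ.symm (1, X)) (symm_one_ne_zero φ X)
  source := {p | Projectivization.lift (fun v => (φ v.1).1 ≠ 0) (by
    rintro ⟨a, ha⟩ ⟨b, hb⟩ t (rfl : a = t • b)
    have ht : t ≠ 0 := by rintro rfl; simp at ha
    simp [ht]) p}
  target := Set.univ
  map_source' _ _ := Set.mem_univ _
  map_target' X _ := by simp
  left_inv' p := by
    induction p using Projectivization.ind with | _ v hv =>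
    intro (hp : (φ v).1 ≠ 0)
    rw [Projectivization.lift_mk, Projectivization.mk_eq_mk_iff']
    refine ⟨(φ v).1⁻¹, φ.injective ?_⟩
    ext <;> simp [hp]
  right_inv' X _ := by simp
  open_source := by
    rw [← isQuotientMap_mk'.isOpen_preimage]
    exact isOpen_ne_fun (by fun_prop) continuous_const
  open_target := isOpen_univ
  continuousOn_toFun := by
    rw [isQuotientMap_mk'.continuousOn_isOpen_iff]
    · change ContinuousOn (fun v : {v : W // v ≠ 0} => (φ v.1).1⁻¹ • (φ v.1).2)
        {v | (φ v.1).1 ≠ 0}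
      exact ContinuousOn.smul (ContinuousOn.inv₀ (by fun_prop) (fun _ h => h)) (by fun_prop)
    · rw [← isQuotientMap_mk'.isOpen_preimage]
      exact isOpen_ne_fun (by fun_prop) continuous_const
  continuousOn_invFun := by
    apply Continuous.continuousOn
    refine isQuotientMap_mk'.continuous.comp
      (f := fun X => (⟨φ.symm (1, X), symm_one_ne_zero φ X⟩ : {v : W // v ≠ 0})) ?_
    fun_prop

theorem exists_coordinates (n : ℕ) [hW : Fact (Module.finrank ℝ W = n + 1)] (v : W) (hv : v ≠ 0) :
    ∃ φ : W ≃L[ℝ] ℝ × E n, φ v = (1, 0) := by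
  have : FiniteDimensional ℝ W := .of_finrank_pos (by rw [hW.out]; omega)
  have h : Module.finrank ℝ W = Module.finrank ℝ (ℝ × E n) := by
    rw [hW.out, Module.finrank_prod]; simp [add_comm]
  let e := ContinuousLinearEquiv.ofFinrankEq h
  obtain ⟨a, ha⟩ := SeparatingDual.exists_continuousLinearEquiv_apply_eq (R := ℝ)
    (x := e v) (y := ((1, 0) : ℝ × E n)) (by simpa using hv) (by simp)
  exact ⟨e.trans a, ha⟩

theorem exists_adapted (n : ℕ) [hW : Fact (Module.finrank ℝ W = n + 1)] (p : ℙ ℝ W) :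
    ∃ φ : W ≃L[ℝ] ℝ × E n, Projectivization.mk ℝ (φ.symm (1, 0)) (symm_one_ne_zero φ 0) = p := by
  obtain ⟨φ, hφ⟩ := exists_coordinates n p.rep p.rep_nonzero
  refine ⟨φ, ?_⟩
  conv_rhs => rw [← p.mk_rep]
  congr 1
  rw [← hφ, φ.symm_apply_apply]

/-- The projective space with the atlas of all affine charts. -/
instance (n : ℕ) [Fact (Module.finrank ℝ W = n + 1)] : ChartedSpace (E n) (ℙ ℝ W) where
  atlas := Set.range affineChart
  chartAt p := affineChart (exists_adapted n p).choose
  mem_chart_source p := by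
    have h := (affineChart (exists_adapted n p).choose).map_target (Set.mem_univ 0)
    have e : (affineChart (exists_adapted n p).choose).symm 0 = p :=
      (exists_adapted n p).choose_spec
    rwa [e] at h
  chart_mem_atlas _ := Set.mem_range_self _

end ProjectiveSpace

/-! ### The projective group and the stabilizer of the center -/

section Groups

variable (W : Type*) [NormedAddCommGroup W] [NormedSpace ℝ W]

/-- The group of projective transformations: the permutations `f` of the projective space of the
form `[v] ↦ [u v]` for an invertible linear operator `u` of `W`. -/
def projectiveGroup : Subgroup (Equiv.Perm (ℙ ℝ W)) :=
  (MulAction.toPermHom (W →L[ℝ] W)ˣ (ℙ ℝ W)).range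

/-- The projective transformation induced by an invertible linear operator. -/
def toProj : (W →L[ℝ] W)ˣ →* projectiveGroup W :=
  (MulAction.toPermHom (W →L[ℝ] W)ˣ (ℙ ℝ W)).rangeRestrict

/-- The projective group carries the quotient topology of the general linear group. -/
instance : TopologicalSpace (projectiveGroup W) :=
  TopologicalSpace.coinduced (toProj W) inferInstance

variable {W}

/-- The stabilizer of the point `A` in the projective group (with the subspace topology). -/
abbrev centerStabilizer (A : ℙ ℝ W) : Subgroup (projectiveGroup W) :=
  MulAction.stabilizer (projectiveGroup W) A

theorem toProj_surjective : Function.Surjective (toProj W) :=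
  MonoidHom.rangeRestrict_surjective _

theorem toProj_smul_mk (u : (W →L[ℝ] W)ˣ) (v : W) (hv : v ≠ 0) :
    ∃ h, toProj W u • Projectivization.mk ℝ v hv = Projectivization.mk ℝ ((u : W →L[ℝ] W) v) h :=
  ⟨_, rfl⟩

theorem isOpenQuotientMap_toProj : IsOpenQuotientMap (toProj W) where
  surjective := toProj_surjective
  continuous := continuous_coinduced_rng
  isOpenMap U hU := by
    rw [isOpen_coinduced]
    have : toProj W ⁻¹' (toProj W '' U) = ⋃ k ∈ (toProj W).ker, (fun u => u * k) ⁻¹' U := by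
      ext u
      simp only [Set.mem_preimage, Set.mem_image, Set.mem_iUnion, exists_prop]
      constructor
      · rintro ⟨w, hw, h⟩
        exact ⟨u⁻¹ * w, by simp [MonoidHom.mem_ker, h], by simpa using hw⟩
      · rintro ⟨k, hk, h⟩
        exact ⟨u * k, h, by simp [MonoidHom.mem_ker.1 hk]⟩
    rw [this]
    exact isOpen_biUnion fun k _ => hU.preimage (by fun_prop)

end Groups

/-! ### Coordinates on the stabilizer -/

section Coordinates

variable {W : Type*} [NormedAddCommGroup W] [NormedSpace ℝ W] {n : ℕ}

/-- Linear coordinates on `W` are adapted to `A` if `A = (1 : 0 : … : 0)`. -/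
def IsAdapted (A : ℙ ℝ W) (φ : W ≃L[ℝ] ℝ × E n) : Prop :=
  Projectivization.mk ℝ (φ.symm (1, 0)) (symm_one_ne_zero φ 0) = A

/-- The coefficient `u⁰₀` of an operator in the coordinates `φ`. -/
def coeff (φ : W ≃L[ℝ] ℝ × E n) (u : W →L[ℝ] W) : ℝ := (φ (u (φ.symm (1, 0)))).1

/-- The row `(u⁰₁/u⁰₀, …, u⁰ₙ/u⁰₀)`, as a linear form. -/
def rowPart (φ : W ≃L[ℝ] ℝ × E n) (u : W →L[ℝ] W) : E n →L[ℝ] ℝ :=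
  (coeff φ u)⁻¹ • (ContinuousLinearMap.fst ℝ ℝ (E n) ∘L (φ : W →L[ℝ] ℝ × E n) ∘L u ∘L
    (φ.symm : ℝ × E n →L[ℝ] W) ∘L ContinuousLinearMap.inr ℝ ℝ (E n))

/-- The block `(uʲᵢ/u⁰₀)` with `i, j ≥ 1`, as a linear operator. -/
def linPart (φ : W ≃L[ℝ] ℝ × E n) (u : W →L[ℝ] W) : E n →L[ℝ] E n :=
  (coeff φ u)⁻¹ • (ContinuousLinearMap.snd ℝ ℝ (E n) ∘L (φ : W →L[ℝ] ℝ × E n) ∘L u ∘L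
    (φ.symm : ℝ × E n →L[ℝ] W) ∘L ContinuousLinearMap.inr ℝ ℝ (E n))

/-- The operator which in the coordinates `φ` is `(c, X) ↦ (c + α X, T X)`. -/
def blockMap (φ : W ≃L[ℝ] ℝ × E n) (α : E n →L[ℝ] ℝ) (T : E n →L[ℝ] E n) : W →L[ℝ] W :=
  (φ.symm : ℝ × E n →L[ℝ] W) ∘L
    (ContinuousLinearMap.inl ℝ ℝ (E n) ∘L
        (ContinuousLinearMap.fst ℝ ℝ (E n) + α ∘L ContinuousLinearMap.snd ℝ ℝ (E n)) +
      ContinuousLinearMap.inr ℝ ℝ (E n) ∘L T ∘L ContinuousLinearMap.snd ℝ ℝ (E n)) ∘L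
    (φ : W →L[ℝ] ℝ × E n)

theorem blockMap_apply (φ : W ≃L[ℝ] ℝ × E n) (α : E n →L[ℝ] ℝ) (T : E n →L[ℝ] E n) (w : W) :
    blockMap φ α T w = φ.symm ((φ w).1 + α (φ w).2, T (φ w).2) := by
  simp [blockMap, ← map_add]

/-- The invertible operator which in the coordinates `φ` is `(c, X) ↦ (c + α X, T X)`. -/
def blockUnit (φ : W ≃L[ℝ] ℝ × E n) (α : E n →L[ℝ] ℝ) (T : (E n →L[ℝ] E n)ˣ) :
    (W →L[ℝ] W)ˣ where
  val := blockMap φ α T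
  inv := blockMap φ (-(α ∘L (↑T⁻¹ : E n →L[ℝ] E n))) (↑T⁻¹ : E n →L[ℝ] E n)
  val_inv := by
    ext w
    have h : ∀ x, (T : E n →L[ℝ] E n) ((↑T⁻¹ : E n →L[ℝ] E n) x) = x := fun x => by
      rw [← mul_apply_eq_comp, Units.mul_inv]; rfl
    simp [blockMap_apply, h]
  inv_val := by
    ext w
    have h : ∀ x, (↑T⁻¹ : E n →L[ℝ] E n) ((T : E n →L[ℝ] E n) x) = x := fun x => by
      rw [← mul_apply_eq_comp, Units.inv_mul]; rfl
    simp [blockMap_apply, h]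

theorem continuous_blockMap {X : Type*} [TopologicalSpace X] (φ : W ≃L[ℝ] ℝ × E n)
    {α : X → E n →L[ℝ] ℝ} {T : X → E n →L[ℝ] E n} (hα : Continuous α) (hT : Continuous T) :
    Continuous fun x => blockMap φ (α x) (T x) := by
  refine continuous_const.clm_comp (Continuous.clm_comp (Continuous.add ?_ ?_) continuous_const)
  · exact continuous_const.clm_comp (continuous_const.add (hα.clm_comp continuous_const))
  · exact continuous_const.clm_comp (hT.clm_comp continuous_const)

theorem continuous_blockUnit (φ : W ≃L[ℝ] ℝ × E n) :
    Continuous fun p : (E n →L[ℝ] ℝ) × (E n →L[ℝ] E n)ˣ => blockUnit φ p.1 p.2 := by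
  have h1 : Continuous fun p : (E n →L[ℝ] ℝ) × (E n →L[ℝ] E n)ˣ => (p.2 : E n →L[ℝ] E n) :=
    Units.continuous_val.comp continuous_snd
  have h2 : Continuous fun p : (E n →L[ℝ] ℝ) × (E n →L[ℝ] E n)ˣ =>
      (↑(p.2⁻¹) : E n →L[ℝ] E n) :=
    Units.continuous_val.comp continuous_snd.inv
  rw [Units.continuous_iff]
  exact ⟨continuous_blockMap φ continuous_fst h1,
    continuous_blockMap φ (continuous_fst.clm_comp h2).neg h2⟩

variable {A : ℙ ℝ W} {φ : W ≃L[ℝ] ℝ × E n}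

theorem toProj_mem_iff (hφ : IsAdapted A φ) (u : (W →L[ℝ] W)ˣ) :
    toProj W u ∈ centerStabilizer A ↔
      ∃ c : ℝ, c ≠ 0 ∧ φ ((u : W →L[ℝ] W) (φ.symm (1, 0))) = (c, 0) := by
  subst hφ
  obtain ⟨h, e⟩ := toProj_smul_mk u _ (symm_one_ne_zero φ 0)
  rw [MulAction.mem_stabilizer_iff, e, Projectivization.mk_eq_mk_iff']
  constructor
  · rintro ⟨c, hc⟩
    refine ⟨c, ?_, by rw [← hc]; simp⟩
    rintro rfl
    exact h (by rw [← hc, zero_smul])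
  · rintro ⟨c, -, hc⟩
    refine ⟨c, φ.injective ?_⟩
    rw [hc]; simp

theorem phi_apply (hφ : IsAdapted A φ) (u : (W →L[ℝ] W)ˣ)
    (hu : toProj W u ∈ centerStabilizer A) :
    coeff φ u ≠ 0 ∧ ∀ w : W, (u : W →L[ℝ] W) w =
      (coeff φ u) • blockMap φ (rowPart φ u) (linPart φ u) w := by
  obtain ⟨c, hc, h⟩ := (toProj_mem_iff hφ u).1 hu
  have hcc : coeff φ u = c := by rw [coeff, h]
  refine ⟨hcc ▸ hc, fun w => φ.injective ?_⟩
  have key : φ ((u : W →L[ℝ] W) w) =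
      (φ w).1 • (c, 0) + φ ((u : W →L[ℝ] W) (φ.symm (0, (φ w).2))) := by
    rw [← h, ← map_smul, ← map_smul, ← map_smul, ← map_add, ← map_add, ← map_add]
    congr 2
    apply φ.injective
    ext <;> simp
  rw [key, blockMap_apply, rowPart, linPart, hcc]
  ext <;> simp [hc, mul_add, mul_comm]

theorem isUnit_linPart (hφ : IsAdapted A φ) (u : (W →L[ℝ] W)ˣ)
    (hu : toProj W u ∈ centerStabilizer A) : IsUnit (linPart φ (u : W →L[ℝ] W)) := by
  obtain ⟨hc, h⟩ := phi_apply hφ u hu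
  have hinj : Function.Injective (linPart φ (u : W →L[ℝ] W)) := by
    rw [injective_iff_map_eq_zero]
    intro X hX
    have h0 := h (φ.symm (-(rowPart φ u X), X))
    rw [blockMap_apply] at h0
    simp only [ContinuousLinearEquiv.apply_symm_apply, neg_add_cancel, hX] at h0
    have h1 : (φ.symm (-(rowPart φ u X), X)) = 0 := by
      rw [show ((0 : ℝ), (0 : E n)) = 0 from rfl, map_zero, smul_zero] at h0
      have := congrArg ((↑u⁻¹ : W →L[ℝ] W)) h0
      rw [← mul_apply_eq_comp, Units.inv_mul, map_zero] at this
      exact this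
    simpa using (Prod.ext_iff.1 ((map_eq_zero_iff φ.symm φ.symm.injective).1 h1)).2
  rw [ContinuousLinearMap.isUnit_iff_bijective]
  exact ⟨hinj, LinearMap.injective_iff_surjective
    (f := (linPart φ (u : W →L[ℝ] W) : E n →ₗ[ℝ] E n)) |>.1 hinj⟩

/-- The normalized lift of an element of the stabilizer is determined by its two blocks. -/
theorem toProj_eq_blockUnit (hφ : IsAdapted A φ) (u : (W →L[ℝ] W)ˣ)
    (hu : toProj W u ∈ centerStabilizer A) :
    toProj W u = toProj W (blockUnit φ (rowPart φ u) (isUnit_linPart hφ u hu).unit) := by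
  obtain ⟨hc, h⟩ := phi_apply hφ u hu
  apply Subtype.ext
  ext p
  induction p using Projectivization.ind with | _ v hv =>
  obtain ⟨h1, e1⟩ := toProj_smul_mk u v hv
  obtain ⟨h2, e2⟩ := toProj_smul_mk
    (blockUnit φ (rowPart φ u) (isUnit_linPart hφ u hu).unit) v hv
  refine e1.trans (Eq.trans ?_ e2.symm)
  rw [Projectivization.mk_eq_mk_iff']
  exact ⟨coeff φ u, (h v).symm⟩

theorem blockUnit_mem (hφ : IsAdapted A φ) (α : E n →L[ℝ] ℝ) (T : (E n →L[ℝ] E n)ˣ) :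
    toProj W (blockUnit φ α T) ∈ centerStabilizer A := by
  rw [toProj_mem_iff hφ]
  exact ⟨1, one_ne_zero, by
    change φ (blockMap φ α T _) = _
    simp [blockMap_apply]⟩

theorem parts_smul (φ : W ≃L[ℝ] ℝ × E n) (u : W →L[ℝ] W) (c : ℝ) (hc : c ≠ 0) :
    rowPart φ (c • u) = rowPart φ u ∧ linPart φ (c • u) = linPart φ u := by
  have h : coeff φ (c • u) = c * coeff φ u := by simp [coeff]
  constructor
  · ext X
    simp only [rowPart, h]
    simp [mul_assoc, hc]
  · ext X : 1
    simp only [linPart, h]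
    simp [smul_smul, hc]

/-- Two operators inducing the same projective transformation are proportional. -/
theorem eq_smul_of_toProj_eq {u w : (W →L[ℝ] W)ˣ} (h : toProj W u = toProj W w) :
    ∃ c : ℝ, (w : W →L[ℝ] W) = c • (u : W →L[ℝ] W) := by
  have hu : ∀ x, (u : W →L[ℝ] W) ((↑u⁻¹ : W →L[ℝ] W) x) = x := fun x => by
    rw [← mul_apply_eq_comp, Units.mul_inv]; rfl
  obtain ⟨c, hc⟩ := LinearMap.exists_eq_smul_id_of_forall_notLinearIndependent
    (f := (((↑u⁻¹ : W →L[ℝ] W) * (w : W →L[ℝ] W) : W →L[ℝ] W) : W →ₗ[ℝ] W)) (fun v hli => by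
      have hv : v ≠ 0 := hli.ne_zero 0
      obtain ⟨h1, e1⟩ := toProj_smul_mk u v hv
      obtain ⟨h2, e2⟩ := toProj_smul_mk w v hv
      rw [h, e2, Projectivization.mk_eq_mk_iff'] at e1
      obtain ⟨a, ha⟩ := e1
      rw [LinearIndependent.pair_iff' hv] at hli
      refine hli a ?_
      simp only [ContinuousLinearMap.coe_coe, mul_apply_eq_comp]
      rw [← ha, map_smul, ← mul_apply_eq_comp, Units.inv_mul]
      rfl)
  refine ⟨c, ?_⟩
  ext v
  have := congrArg (u : W →L[ℝ] W) (LinearMap.congr_fun hc v)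
  simpa [hu] using this

theorem parts_eq_of_toProj_eq (hφ : IsAdapted A φ) {u w : (W →L[ℝ] W)ˣ}
    (h : toProj W u = toProj W w) (hw : toProj W w ∈ centerStabilizer A) :
    rowPart φ (w : W →L[ℝ] W) = rowPart φ u ∧ linPart φ (w : W →L[ℝ] W) = linPart φ u := by
  obtain ⟨c, hc⟩ := eq_smul_of_toProj_eq h
  have hc0 : c ≠ 0 := by
    rintro rfl
    apply (phi_apply hφ w hw).1
    rw [hc]; simp [coeff]
  rw [hc]
  exact parts_smul φ _ c hc0

/-- An invertible operator of `W` inducing a given element of the stabilizer. -/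
def someLift (f : centerStabilizer A) : (W →L[ℝ] W)ˣ := (toProj_surjective f.1).choose

theorem toProj_someLift (f : centerStabilizer A) : toProj W (someLift f) = f.1 :=
  (toProj_surjective f.1).choose_spec

theorem continuous_of_comp {X : Type*} [TopologicalSpace X] {F : centerStabilizer A → X}
    (G : (W →L[ℝ] W)ˣ → X) (hG : ContinuousOn G {u | toProj W u ∈ centerStabilizer A})
    (h : ∀ u (hu : toProj W u ∈ centerStabilizer A), F ⟨toProj W u, hu⟩ = G u) :
    Continuous F := by
  have hq : IsOpenQuotientMap
      ((centerStabilizer A : Set (projectiveGroup W)).restrictPreimage (toProj W)) :=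
    ⟨Set.restrictPreimage_surjective _ toProj_surjective,
      isOpenQuotientMap_toProj.continuous.restrictPreimage,
      isOpenQuotientMap_toProj.isOpenMap.restrictPreimage _⟩
  refine hq.continuous_comp_iff.1 ?_
  have := continuousOn_iff_continuous_domRestrict.1 hG
  exact this.congr fun u => (h u.1 u.2).symm

theorem continuous_parts (φ : W ≃L[ℝ] ℝ × E n) :
    ContinuousOn (fun u : W →L[ℝ] W => (rowPart φ u, linPart φ u)) {u | coeff φ u ≠ 0} := by
  have hc : Continuous fun u : W →L[ℝ] W => coeff φ u := by unfold coeff; fun_prop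
  have hi := hc.continuousOn.inv₀ (s := {u : W →L[ℝ] W | coeff φ u ≠ 0}) (fun _ h => h)
  exact (hi.smul (continuous_const.clm_comp (continuous_const.clm_comp (continuous_id.clm_comp
      continuous_const))).continuousOn).prodMk
    (hi.smul (continuous_const.clm_comp (continuous_const.clm_comp (continuous_id.clm_comp
      continuous_const))).continuousOn)

/-- Coordinates on the stabilizer of `A` given by adapted linear coordinates: an element `f` is
sent to the unique pair `(α, T)` such that `f` is `X ↦ T X / (1 + α X)` in the affine chart, that
is, such that `f` is induced by the operator `(c, X) ↦ (c + α X, T X)`. -/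
def stabilizerCoord (hφ : IsAdapted A φ) :
    centerStabilizer A ≃ₜ (E n →L[ℝ] ℝ) × (E n →L[ℝ] E n)ˣ where
  toFun f := (rowPart φ (someLift f),
    (isUnit_linPart hφ (someLift f) (by rw [toProj_someLift]; exact f.2)).unit)
  invFun p := ⟨toProj W (blockUnit φ p.1 p.2), blockUnit_mem hφ p.1 p.2⟩
  left_inv f := Subtype.ext <| by
    have h := toProj_eq_blockUnit hφ (someLift f) (by rw [toProj_someLift]; exact f.2)
    exact h.symm.trans (toProj_someLift f)
  right_inv p := by
    have h := parts_eq_of_toProj_eq hφ (u := blockUnit φ p.1 p.2)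
      (toProj_someLift ⟨toProj W (blockUnit φ p.1 p.2), blockUnit_mem hφ p.1 p.2⟩).symm
      (by rw [toProj_someLift]; exact blockUnit_mem hφ p.1 p.2)
    have hv : ((blockUnit φ p.1 p.2 : (W →L[ℝ] W)ˣ) : W →L[ℝ] W) = blockMap φ p.1 p.2 := rfl
    have hc : coeff φ (blockMap φ p.1 p.2) = 1 := by simp [coeff, blockMap_apply]
    refine Prod.ext (h.1.trans ?_) (Units.ext (h.2.trans ?_))
    · rw [hv]; ext X; simp [rowPart, hc, blockMap_apply]
    · rw [hv]; ext X : 1; simp [linPart, hc, blockMap_apply]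
  continuous_toFun := by
    have hemb : Topology.IsEmbedding (Prod.map id Units.val :
        (E n →L[ℝ] ℝ) × (E n →L[ℝ] E n)ˣ → (E n →L[ℝ] ℝ) × (E n →L[ℝ] E n)) :=
      Topology.IsEmbedding.id.prodMap Units.isOpenEmbedding_val.isEmbedding
    rw [hemb.continuous_iff]
    refine continuous_of_comp (fun u : (W →L[ℝ] W)ˣ => (rowPart φ (u : W →L[ℝ] W), linPart φ u))
      ((continuous_parts φ).comp Units.continuous_val.continuousOn
        fun u hu => (phi_apply hφ u hu).1) fun u hu => ?_
    have h := parts_eq_of_toProj_eq hφ (u := u) (toProj_someLift ⟨toProj W u, hu⟩).symm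
      (by rw [toProj_someLift]; exact hu)
    exact Prod.ext h.1 h.2
  continuous_invFun :=
    (isOpenQuotientMap_toProj.continuous.comp (continuous_blockUnit φ)).subtype_mk _

/-- The model space of the stabilizer. -/
abbrev StabilizerModel (n : ℕ) : Type := (E n →L[ℝ] ℝ) × (E n →L[ℝ] E n)

theorem isOpenEmbedding_stabilizerCoord (hφ : IsAdapted A φ) :
    Topology.IsOpenEmbedding fun f : centerStabilizer A =>
      (((stabilizerCoord hφ f).1, ((stabilizerCoord hφ f).2 : E n →L[ℝ] E n)) :
        StabilizerModel n) :=
  (Topology.IsOpenEmbedding.id.prodMap Units.isOpenEmbedding_val).comp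
    (stabilizerCoord hφ).isOpenEmbedding

/-- The global chart `f ↦ (α, T)` of the stabilizer given by adapted linear coordinates. -/
def stabilizerChart (hφ : IsAdapted A φ) :
    OpenPartialHomeomorph (centerStabilizer A) (StabilizerModel n) :=
  (isOpenEmbedding_stabilizerCoord hφ).toOpenPartialHomeomorph

/-- The stabilizer with the atlas of all charts given by adapted linear coordinates. -/
instance (n : ℕ) [Fact (Module.finrank ℝ W = n + 1)] (A : ℙ ℝ W) :
    ChartedSpace (StabilizerModel n) (centerStabilizer A) where
  atlas := {e | ∃ (φ : W ≃L[ℝ] ℝ × E n) (hφ : IsAdapted A φ), e = stabilizerChart hφ}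
  chartAt _ := stabilizerChart (exists_adapted n A).choose_spec
  mem_chart_source _ := Set.mem_univ _
  chart_mem_atlas _ := ⟨_, (exists_adapted n A).choose_spec, rfl⟩

end Coordinates

/-! ### The tangent space at the center and the linearizing map -/

section Linearization

variable {W : Type*} [NormedAddCommGroup W] [NormedSpace ℝ W]

/-- The tangent space of the projective space at `A`. -/
def CenterTangent (n : ℕ) [Fact (Module.finrank ℝ W = n + 1)] (A : ℙ ℝ W) : Type :=
  TangentSpace (𝓡 n) A

variable (n : ℕ) [Fact (Module.finrank ℝ W = n + 1)] (A : ℙ ℝ W)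

/-- An auxiliary norm on the tangent space (a finite-dimensional space, so that the choice is
irrelevant), which makes its general linear group a Lie group. -/
instance : NormedAddCommGroup (CenterTangent n A) := inferInstanceAs (NormedAddCommGroup (E n))

instance : NormedSpace ℝ (CenterTangent n A) := inferInstanceAs (NormedSpace ℝ (E n))

instance : FiniteDimensional ℝ (CenterTangent n A) :=
  inferInstanceAs (FiniteDimensional ℝ (E n))

instance : CompleteSpace (CenterTangent n A) := inferInstanceAs (CompleteSpace (E n))

variable {A}

/-- The differential `d_A f`. As `f A = A`, its codomain, the tangent space at `f A`, is the tangent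
space at `A`. -/
def differentialAtCenter (f : centerStabilizer A) : CenterTangent n A →L[ℝ] CenterTangent n A :=
  mfderiv (𝓡 n) (𝓡 n) (fun p : ℙ ℝ W => f • p) A

end Linearization

/-! ### Quotients of Lie groups -/

/-- The charts `cs` make the topological group `G ⧸ N` the quotient Lie group of `G` by `N`: they
make it a Lie group for which the projection of `G` onto it is a smooth submersion. -/
def IsQuotientLieGroup (F : Type*) {G F' : Type*} [NormedAddCommGroup F] [NormedSpace ℝ F]
    [Group G] [TopologicalSpace G] [ChartedSpace F G]
    [NormedAddCommGroup F'] [NormedSpace ℝ F'] (N : Subgroup G) [N.Normal]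
    (_ : ChartedSpace F' (G ⧸ N)) : Prop :=
  LieGroup 𝓘(ℝ, F') ∞ (G ⧸ N) ∧
    Manifold.IsSubmersion 𝓘(ℝ, F) 𝓘(ℝ, F') ∞ (QuotientGroup.mk : G → G ⧸ N)

end CenteredProjective

end

open CenteredProjective

noncomputable section

namespace CenteredProjective

/-! ### Smooth structures on the projective space and on the stabilizer. -/

section Smoothness

variable {W : Type*} [NormedAddCommGroup W] [NormedSpace ℝ W] {n : ℕ}

/-! In coordinates adapted to $A$, an element of $G$ has exactly one lift of the form
$(c,X)\mapsto(c+\alpha X,TX)$. In the affine chart centered at $A$ it therefore acts as $X\mapsto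
TX/(1+\alpha X)$, whose derivative at $0$ is $T$ (`hasFDerivAt_fractionalLinear`). So the
linearizing map is nothing but the projection $(\alpha,T)\mapsto T$.

Normalized lifts multiply by $(\alpha,T)(\beta,S)=(\beta+\alpha S,\,TS)$ (`stabilizerCoord_mul`).
This makes $G$ a Lie group and the projection a homomorphism. The map $T\mapsto(0,T)$ is a smooth
section of it (`contMDiff_linearizationSection`), so it is surjective, and its kernel is closed as
the preimage of a point.

The section composed with $\pi\colon G\to G/H$ inverts $\bar\beta$, so $\bar\beta$ is a
homeomorphism. Transporting the smooth structure of $GL(V)$ along it gives a quotient Lie group in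
which $\pi$ reads $(\alpha,T)\mapsto T$. For an arbitrary quotient structure, $\bar\beta^{-1}$ is
smooth as $\pi$ composed with the section. The map $\bar\beta$ is smooth because
$\bar\beta\circ\pi=\beta$ is, and a submersion has smooth local sections
(`contMDiff_of_comp_isSubmersion`). -/

theorem contDiffOn_affineChart_transition (φ ψ : W ≃L[ℝ] ℝ × E n) :
    ContDiffOn ℝ ∞ (affineChart φ ∘ (affineChart ψ).symm)
      {X : E n | (φ (ψ.symm (1, X))).1 ≠ 0} := by
  change ContDiffOn ℝ ∞ (fun X => (φ (ψ.symm (1, X))).1⁻¹ • (φ (ψ.symm (1, X))).2) _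
  have h : ContDiff ℝ ∞ fun X : E n => φ (ψ.symm (1, X)) :=
    φ.contDiff.comp (ψ.symm.contDiff.comp (contDiff_const.prodMk contDiff_id))
  exact (h.fst.contDiffOn.inv fun _ hx => hx).smul h.snd.contDiffOn

instance isManifold_projectivization (n : ℕ) [Fact (Module.finrank ℝ W = n + 1)] :
    IsManifold (𝓡 n) ∞ (ℙ ℝ W) := by
  refine isManifold_of_contDiffOn _ _ _ ?_
  rintro _ _ ⟨ψ, rfl⟩ ⟨φ, rfl⟩
  refine (contDiffOn_affineChart_transition φ ψ).mono ?_
  rintro X ⟨⟨-, hX⟩, -⟩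
  exact hX

theorem contDiff_blockMap (φ : W ≃L[ℝ] ℝ × E n) :
    ContDiff ℝ ∞ fun p : StabilizerModel n => blockMap φ p.1 p.2 := by
  refine contDiff_const.clm_comp (ContDiff.clm_comp (ContDiff.add ?_ ?_) contDiff_const)
  · exact contDiff_const.clm_comp (contDiff_const.add (contDiff_fst.clm_comp contDiff_const))
  · exact contDiff_const.clm_comp (contDiff_snd.clm_comp contDiff_const)

theorem contDiffOn_parts (φ : W ≃L[ℝ] ℝ × E n) :
    ContDiffOn ℝ ∞ (fun u : W →L[ℝ] W => ((rowPart φ u, linPart φ u) : StabilizerModel n))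
      {u | coeff φ u ≠ 0} := by
  have hc : ContDiff ℝ ∞ fun u : W →L[ℝ] W => coeff φ u :=
    (φ.contDiff.comp (contDiff_id.clm_apply contDiff_const)).fst
  have hi := hc.contDiffOn.inv (s := {u : W →L[ℝ] W | coeff φ u ≠ 0}) (fun _ h => h)
  exact (hi.smul (contDiff_const.clm_comp (contDiff_const.clm_comp (contDiff_id.clm_comp
      contDiff_const))).contDiffOn).prodMk
    (hi.smul (contDiff_const.clm_comp (contDiff_const.clm_comp (contDiff_id.clm_comp
      contDiff_const))).contDiffOn)

variable {A : ℙ ℝ W} {φ ψ : W ≃L[ℝ] ℝ × E n}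

/-- The chart is defined through a chosen lift, but lifts differ by a scalar and the two blocks are
homogeneous of degree zero, so any lift computes it. -/
theorem stabilizerChart_toProj (hφ : IsAdapted A φ) (u : (W →L[ℝ] W)ˣ)
    (hu : toProj W u ∈ centerStabilizer A) :
    stabilizerChart hφ ⟨toProj W u, hu⟩ = (rowPart φ u, linPart φ u) := by
  have h := parts_eq_of_toProj_eq hφ (u := u) (toProj_someLift ⟨toProj W u, hu⟩).symm
    (by rw [toProj_someLift]; exact hu)
  exact Prod.ext h.1 h.2

theorem stabilizerChart_apply (hφ : IsAdapted A φ) (f : centerStabilizer A) :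
    stabilizerChart hφ f =
      ((stabilizerCoord hφ f).1, ((stabilizerCoord hφ f).2 : E n →L[ℝ] E n)) := rfl

theorem mem_stabilizerChart_target (hφ : IsAdapted A φ) {p : StabilizerModel n} :
    p ∈ (stabilizerChart hφ).target ↔ IsUnit p.2 := by
  rw [stabilizerChart, Topology.IsOpenEmbedding.toOpenPartialHomeomorph_target]
  constructor
  · rintro ⟨f, rfl⟩
    exact (stabilizerCoord hφ f).2.isUnit
  · rintro ⟨T, hT⟩
    exact ⟨(stabilizerCoord hφ).symm (p.1, T), by
      simp only [Homeomorph.apply_symm_apply, hT]⟩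

theorem stabilizerChart_symm_apply (hφ : IsAdapted A φ) (α : E n →L[ℝ] ℝ) (T : (E n →L[ℝ] E n)ˣ) :
    (stabilizerChart hφ).symm (α, (T : E n →L[ℝ] E n)) = (stabilizerCoord hφ).symm (α, T) := by
  have h := (stabilizerChart hφ).left_inv (x := (stabilizerCoord hφ).symm (α, T)) (Set.mem_univ _)
  rwa [stabilizerChart_apply, Homeomorph.apply_symm_apply] at h

/-- A change of charts takes the lift normalized in `φ` and reads its blocks in `ψ`. The lift is
affine in $(\alpha,T)$ and the blocks are rational, with denominator `coeff ψ`, which does not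
vanish since the lift preserves the line $A$. -/
instance isManifold_centerStabilizer [Fact (Module.finrank ℝ W = n + 1)] :
    IsManifold 𝓘(ℝ, StabilizerModel n) ∞ (centerStabilizer A) := by
  refine isManifold_of_contDiffOn _ _ _ ?_
  rintro _ _ ⟨φ, hφ, rfl⟩ ⟨ψ, hψ, rfl⟩
  have key : ∀ p : StabilizerModel n, IsUnit p.2 →
      coeff ψ (blockMap φ p.1 p.2) ≠ 0 ∧ stabilizerChart hψ ((stabilizerChart hφ).symm p) =
        (rowPart ψ (blockMap φ p.1 p.2), linPart ψ (blockMap φ p.1 p.2)) := by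
    rintro ⟨α, _⟩ ⟨T, rfl⟩
    refine ⟨(phi_apply hψ (blockUnit φ α T) (blockUnit_mem hφ α T)).1, ?_⟩
    rw [stabilizerChart_symm_apply]
    exact stabilizerChart_toProj hψ (blockUnit φ α T) (blockUnit_mem hφ α T)
  have hs : ∀ p ∈ 𝓘(ℝ, StabilizerModel n).symm ⁻¹'
      ((stabilizerChart hφ).symm ≫ₕ stabilizerChart hψ).source ∩
      Set.range 𝓘(ℝ, StabilizerModel n), IsUnit p.2 :=
    fun p hp => (mem_stabilizerChart_target hφ).1 hp.1.1
  refine ((contDiffOn_parts ψ).comp (contDiff_blockMap φ).contDiffOn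
    fun p hp => (key p (hs p hp)).1).congr fun p hp => (key p (hs p hp)).2

theorem stabilizerChart_mem_maximalAtlas [Fact (Module.finrank ℝ W = n + 1)]
    (hφ : IsAdapted A φ) :
    stabilizerChart hφ ∈ IsManifold.maximalAtlas 𝓘(ℝ, StabilizerModel n) ∞ (centerStabilizer A) :=
  IsManifold.subset_maximalAtlas ⟨φ, hφ, rfl⟩

theorem contMDiff_stabilizerChart [Fact (Module.finrank ℝ W = n + 1)] (hφ : IsAdapted A φ) :
    ContMDiff 𝓘(ℝ, StabilizerModel n) 𝓘(ℝ, StabilizerModel n) ∞ (stabilizerChart hφ) :=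
  contMDiffOn_univ.1 (contMDiffOn_of_mem_maximalAtlas (stabilizerChart_mem_maximalAtlas hφ))

/-- A map into the stabilizer is smooth as soon as its coordinates are. -/
theorem contMDiff_of_stabilizerChart_comp [Fact (Module.finrank ℝ W = n + 1)]
    (hφ : IsAdapted A φ)
    {H M E' : Type*} [NormedAddCommGroup E'] [NormedSpace ℝ E'] [TopologicalSpace H]
    {I : ModelWithCorners ℝ E' H} [TopologicalSpace M] [ChartedSpace H M]
    {F : M → centerStabilizer A}
    (h : ContMDiff I 𝓘(ℝ, StabilizerModel n) ∞ fun x => stabilizerChart hφ (F x)) :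
    ContMDiff I 𝓘(ℝ, StabilizerModel n) ∞ F := by
  have h' := (contMDiffOn_symm_of_mem_maximalAtlas
    (stabilizerChart_mem_maximalAtlas hφ)).comp_contMDiff h
    fun x => (stabilizerChart hφ).map_source (Set.mem_univ _)
  exact h'.congr fun x => ((stabilizerChart hφ).left_inv (Set.mem_univ _)).symm

/-- A product of normalized lifts is again normalized, so the group law can be computed on operators
without rescaling. -/
theorem blockUnit_mul (φ : W ≃L[ℝ] ℝ × E n) (α β : E n →L[ℝ] ℝ) (T S : (E n →L[ℝ] E n)ˣ) :
    blockUnit φ α T * blockUnit φ β S =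
      blockUnit φ (β + α ∘L (S : E n →L[ℝ] E n)) (T * S) := by
  ext w : 2
  change blockMap φ α T (blockMap φ β S w) = blockMap φ _ _ w
  simp [blockMap_apply, add_assoc]

theorem stabilizerCoord_mul (hφ : IsAdapted A φ) (f g : centerStabilizer A) :
    stabilizerCoord hφ (f * g) =
      ((stabilizerCoord hφ g).1 +
        (stabilizerCoord hφ f).1 ∘L ((stabilizerCoord hφ g).2 : E n →L[ℝ] E n),
        (stabilizerCoord hφ f).2 * (stabilizerCoord hφ g).2) := by
  obtain ⟨⟨α, T⟩, rfl⟩ := (stabilizerCoord hφ).symm.surjective f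
  obtain ⟨⟨β, S⟩, rfl⟩ := (stabilizerCoord hφ).symm.surjective g
  simp only [Homeomorph.apply_symm_apply]
  rw [← Homeomorph.eq_symm_apply]
  refine Subtype.ext ?_
  change toProj W (blockUnit φ α T) * toProj W (blockUnit φ β S) = toProj W (blockUnit φ _ _)
  rw [← map_mul, blockUnit_mul]

theorem stabilizerCoord_one (hφ : IsAdapted A φ) : stabilizerCoord hφ 1 = (0, 1) := by
  -- From $1\cdot1=1$: first $T^2=T$ with $T$ invertible, then $\alpha+\alpha=\alpha$.
  have h := stabilizerCoord_mul hφ 1 1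
  rw [mul_one] at h
  have h2 : (stabilizerCoord hφ 1).2 = 1 := by
    simpa using congrArg Prod.snd h
  have h1 := congrArg Prod.fst h
  simp only [h2] at h1
  refine Prod.ext ?_ h2
  ext X
  simpa using congrArg (fun L : E n →L[ℝ] ℝ => L X) h1

theorem stabilizerCoord_inv (hφ : IsAdapted A φ) (f : centerStabilizer A) :
    stabilizerCoord hφ f⁻¹ =
      (-((stabilizerCoord hφ f).1 ∘L
        (((stabilizerCoord hφ f).2⁻¹ : (E n →L[ℝ] E n)ˣ) : E n →L[ℝ] E n)),
        (stabilizerCoord hφ f).2⁻¹) := by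
  have h := stabilizerCoord_mul hφ f f⁻¹
  rw [mul_inv_cancel, stabilizerCoord_one] at h
  have h2 : (stabilizerCoord hφ f⁻¹).2 = (stabilizerCoord hφ f).2⁻¹ :=
    eq_inv_of_mul_eq_one_right (congrArg Prod.snd h).symm
  refine Prod.ext ?_ h2
  rw [← h2]
  exact eq_neg_of_add_eq_zero_left (congrArg Prod.fst h).symm

instance lieGroup_centerStabilizer [Fact (Module.finrank ℝ W = n + 1)] :
    LieGroup 𝓘(ℝ, StabilizerModel n) ∞ (centerStabilizer A) where
  contMDiff_mul := by
    obtain ⟨φ, hφ : IsAdapted A φ⟩ := exists_adapted n A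
    refine contMDiff_of_stabilizerChart_comp hφ ?_
    have hf := (contMDiff_stabilizerChart hφ).comp (contMDiff_fst
      (I := 𝓘(ℝ, StabilizerModel n)) (J := 𝓘(ℝ, StabilizerModel n)) (n := ∞)
      (M := centerStabilizer A) (N := centerStabilizer A))
    have hg := (contMDiff_stabilizerChart hφ).comp (contMDiff_snd
      (I := 𝓘(ℝ, StabilizerModel n)) (J := 𝓘(ℝ, StabilizerModel n)) (n := ∞)
      (M := centerStabilizer A) (N := centerStabilizer A))
    -- The product law is polynomial, hence smooth on the whole model space and not only at
    -- invertible $T$.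
    have hμ : ContDiff ℝ ∞ fun p : StabilizerModel n × StabilizerModel n =>
        ((p.2.1 + p.1.1 ∘L p.2.2, p.1.2 ∘L p.2.2) : StabilizerModel n) :=
      (contDiff_snd.fst.add (contDiff_fst.fst.clm_comp contDiff_snd.snd)).prodMk
        (contDiff_fst.snd.clm_comp contDiff_snd.snd)
    refine (hμ.contMDiff.comp (hf.prodMk_space hg)).congr fun x => ?_
    simp only [stabilizerChart_apply, stabilizerCoord_mul, Function.comp_apply]
    rfl
  contMDiff_inv := by
    obtain ⟨φ, hφ : IsAdapted A φ⟩ := exists_adapted n A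
    refine contMDiff_of_stabilizerChart_comp hφ fun f => ?_
    -- `Ring.inverse` extends $T\mapsto T^{-1}$ to all operators. It is smooth only at units, which
    -- is why the argument is pointwise.
    have hν : ContDiffAt ℝ ∞ (fun p : StabilizerModel n =>
        ((-(p.1 ∘L Ring.inverse p.2), Ring.inverse p.2) : StabilizerModel n))
        (stabilizerChart hφ f) := by
      have h := (contDiffAt_ringInverse ℝ (n := ∞) (stabilizerCoord hφ f).2).comp
        (stabilizerChart hφ f) (f := Prod.snd) contDiffAt_snd
      exact (contDiffAt_fst.clm_comp h).neg.prodMk h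
    refine (hν.contMDiffAt.comp f (contMDiff_stabilizerChart hφ f)).congr_of_eventuallyEq
      (Filter.Eventually.of_forall fun g => ?_)
    simp only [stabilizerChart_apply, stabilizerCoord_inv, Function.comp_apply, Ring.inverse_unit]

end Smoothness

/-! ### Local sections of submersions and descent of smoothness. -/

section SubmersionDescent

/-- A smooth submersion has a smooth local section through every point of its domain. -/
theorem exists_section_of_isSubmersionAtOfComplement
    {F F' K M N : Type*} [NormedAddCommGroup F] [NormedSpace ℝ F] [NormedAddCommGroup F']
    [NormedSpace ℝ F'] [NormedAddCommGroup K] [NormedSpace ℝ K] [TopologicalSpace M]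
    [ChartedSpace F M] [TopologicalSpace N] [ChartedSpace F' N] {k : ℕ∞ω} {π : M → N} {x : M}
    (h : Manifold.IsSubmersionAtOfComplement K 𝓘(ℝ, F) 𝓘(ℝ, F') k π x) :
    ∃ s : N → M, s (π x) = x ∧ ContMDiffAt 𝓘(ℝ, F') 𝓘(ℝ, F) k s (π x) ∧
      ∀ᶠ y in 𝓝 (π x), π (s y) = y := by
  set e := h.domChart
  set e' := h.codChart
  set L := h.equiv
  have hx : x ∈ e.source := h.mem_domChart_source
  have hy : π x ∈ e'.source := h.mem_codChart_source
  have hw : ∀ z ∈ e.target, e' (π (e.symm z)) = (L z).1 := fun z hz => by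
    have := h.writtenInCharts
      (show z ∈ (h.domChart.extend 𝓘(ℝ, F)).target by simpa [e] using hz)
    simpa [e] using this
  -- In the charts the submersion is the first component of `L`. The section freezes the
  -- complementary component at its value at `x`, so that it passes through `x`.
  let σ : F' → F := fun y => L.symm (y, (L (e x)).2)
  have hσ : ContDiff ℝ k σ := L.symm.contDiff.comp (contDiff_id.prodMk contDiff_const)
  have hσx : σ (e' (π x)) = e x := by
    have := hw (e x) (e.map_source hx)
    rw [e.left_inv hx] at this
    simp [σ, this]
  have he' : ContMDiffAt 𝓘(ℝ, F') 𝓘(ℝ, F') k e' (π x) :=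
    contMDiffAt_of_mem_maximalAtlas h.codChart_mem_maximalAtlas hy
  have hcomp : ContMDiffAt 𝓘(ℝ, F') 𝓘(ℝ, F) k (fun y => σ (e' y)) (π x) :=
    hσ.contMDiff.contMDiffAt.comp _ he'
  refine ⟨fun y => e.symm (σ (e' y)), by simp [hσx, hx], ?_, ?_⟩
  · refine ContMDiffAt.comp (π x) (g := e.symm) ?_ hcomp
    refine contMDiffAt_symm_of_mem_maximalAtlas h.domChart_mem_maximalAtlas ?_
    rw [hσx]
    exact e.map_source hx
  · have ht : ∀ᶠ y in 𝓝 (π x), σ (e' y) ∈ e.target :=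
      hcomp.continuousAt.eventually_mem (e.open_target.mem_nhds (by
        rw [hσx]; exact e.map_source hx))
    filter_upwards [ht, e'.open_source.mem_nhds hy] with y h1 h2
    -- The section identity is checked after applying the codomain chart, which is injective on its
    -- source.
    refine e'.injOn (h.source_subset_preimage_source (e.map_target h1)) h2 ?_
    rw [hw _ h1]
    simp [σ]

/-- A map is smooth if its composition with a surjective smooth submersion is. -/
theorem contMDiff_of_comp_isSubmersion
    {F F' E₁ H₁ M N P : Type*} [NormedAddCommGroup F] [NormedSpace ℝ F] [NormedAddCommGroup F']
    [NormedSpace ℝ F'] [NormedAddCommGroup E₁] [NormedSpace ℝ E₁] [TopologicalSpace H₁]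
    {I : ModelWithCorners ℝ E₁ H₁} [TopologicalSpace M]
    [ChartedSpace F M] [TopologicalSpace N] [ChartedSpace F' N] [TopologicalSpace P]
    [ChartedSpace H₁ P] {k : ℕ∞ω} {π : M → N} {g : N → P}
    (h : Manifold.IsSubmersion 𝓘(ℝ, F) 𝓘(ℝ, F') k π) (hπ : Function.Surjective π)
    (hg : ContMDiff 𝓘(ℝ, F) I k (g ∘ π)) : ContMDiff 𝓘(ℝ, F') I k g := by
  intro y
  obtain ⟨x, rfl⟩ := hπ y
  obtain ⟨K, _, _, hK⟩ := h
  obtain ⟨s, hsx, hs, hsec⟩ := exists_section_of_isSubmersionAtOfComplement (hK x)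
  -- Near `π x` the map `g` equals `(g ∘ π) ∘ s`.
  refine (ContMDiffAt.comp (π x) (g := g ∘ π) hg.contMDiffAt hs).congr_of_eventuallyEq ?_
  filter_upwards [hsec] with z hz
  simp [hz]

end SubmersionDescent

/-! ### The differential at the center, the linearizing map and its section. -/

section Differential

variable {W : Type*} [NormedAddCommGroup W] [NormedSpace ℝ W] {n : ℕ}
  {A : ℙ ℝ W} {φ : W ≃L[ℝ] ℝ × E n}

theorem affineChart_center (hφ : IsAdapted A φ) : affineChart φ A = 0 := by
  rw [← show Projectivization.mk ℝ (φ.symm (1, 0)) (symm_one_ne_zero φ 0) = A from hφ]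
  exact (affineChart φ).right_inv (Set.mem_univ 0)

/-- In an affine chart adapted to the center, an element of the stabilizer is the
fractional-linear map `X ↦ T X / (1 + α X)`. -/
theorem affineChart_smul_symm (hφ : IsAdapted A φ) (f : centerStabilizer A) (X : E n) :
    affineChart φ (f • (affineChart φ).symm X) =
      (1 + (stabilizerCoord hφ f).1 X)⁻¹ • ((stabilizerCoord hφ f).2 : E n →L[ℝ] E n) X := by
  obtain ⟨⟨α, T⟩, rfl⟩ := (stabilizerCoord hφ).symm.surjective f
  simp only [Homeomorph.apply_symm_apply]
  change (φ (blockMap φ α T (φ.symm (1, X)))).1⁻¹ • (φ (blockMap φ α T (φ.symm (1, X)))).2 = _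
  simp [blockMap_apply]

/-- By the product rule, the derivative of the scalar factor is multiplied by $T0=0$, so $\alpha$
does not contribute. -/
theorem hasFDerivAt_fractionalLinear (α : E n →L[ℝ] ℝ) (T : E n →L[ℝ] E n) :
    HasFDerivAt (fun X => (1 + α X)⁻¹ • T X) T 0 := by
  have h1 : HasFDerivAt (fun X => (1 + α X)⁻¹) (-((1 + α 0) ^ 2)⁻¹ • α) 0 :=
    (hasDerivAt_inv (x := 1 + α 0) (by simp)).comp_hasFDerivAt (0 : E n)
      (α.hasFDerivAt.const_add 1)
  exact (h1.smul (T.hasFDerivAt (x := 0))).congr_fderiv (by ext1; simp)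

theorem continuous_smul_projectivization (g : projectiveGroup W) :
    Continuous fun p : ℙ ℝ W => g • p := by
  obtain ⟨u, rfl⟩ := toProj_surjective g
  refine isQuotientMap_mk'.continuous_iff.2 ?_
  have hu : ∀ v : {v : W // v ≠ 0}, (u : W →L[ℝ] W) v ≠ 0 := fun v =>
    (toProj_smul_mk u v.1 v.2).1
  exact isQuotientMap_mk'.continuous.comp
    (f := fun v : {v : W // v ≠ 0} => (⟨(u : W →L[ℝ] W) v, hu v⟩ : {v : W // v ≠ 0}))
    (by fun_prop)

variable [Fact (Module.finrank ℝ W = n + 1)]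

/-- The linear coordinates used by the preferred chart at `A`. -/
def centerCoordinates (n : ℕ) [Fact (Module.finrank ℝ W = n + 1)] (A : ℙ ℝ W) :
    W ≃L[ℝ] ℝ × E n := (exists_adapted n A).choose

theorem isAdapted_centerCoordinates : IsAdapted A (centerCoordinates n A) :=
  (exists_adapted n A).choose_spec

/-- The linear part of an element of the stabilizer in the preferred chart at `A`. -/
def centerLinearPart (n : ℕ) [Fact (Module.finrank ℝ W = n + 1)] {A : ℙ ℝ W}
    (f : centerStabilizer A) : (CenterTangent n A →L[ℝ] CenterTangent n A)ˣ :=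
  (stabilizerCoord (isAdapted_centerCoordinates (n := n)) f).2

theorem hasMFDerivAt_smul (f : centerStabilizer A) :
    HasMFDerivAt (𝓡 n) (𝓡 n) (fun p : ℙ ℝ W => f • p) A
      (centerLinearPart n f : CenterTangent n A →L[ℝ] CenterTangent n A) := by
  have hφ := isAdapted_centerCoordinates (n := n) (A := A)
  have hfA : f • A = A := f.2
  -- The preferred chart at `A` is by definition the affine chart of `centerCoordinates`. This is
  -- the chart that identifies the tangent space with `E n`, so the differential is the block $T$
  -- itself and not a conjugate of it.
  have hA : extChartAt (𝓡 n) A A = (0 : E n) := affineChart_center hφ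
  refine ⟨(continuous_smul_projectivization f.1).continuousAt, ?_⟩
  rw [hA]
  have hw : writtenInExtChartAt (𝓡 n) (𝓡 n) A (fun p : ℙ ℝ W => f • p) =
      fun X : E n => (1 + (stabilizerCoord hφ f).1 X)⁻¹ •
        ((stabilizerCoord hφ f).2 : E n →L[ℝ] E n) X := by
    ext1 X
    -- Since $f$ fixes $A$, the same chart is used at the source and at the target.
    rw [writtenInExtChartAt, hfA]
    exact affineChart_smul_symm hφ f X
  rw [hw]
  exact (hasFDerivAt_fractionalLinear _ _).hasFDerivWithinAt

theorem differentialAtCenter_eq (f : centerStabilizer A) :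
    differentialAtCenter n f = centerLinearPart n f :=
  (hasMFDerivAt_smul f).mfderiv

/-- The linearizing map `f ↦ d_A f`. -/
def linearization (n : ℕ) [Fact (Module.finrank ℝ W = n + 1)] (A : ℙ ℝ W) :
    centerStabilizer A →* (CenterTangent n A →L[ℝ] CenterTangent n A)ˣ :=
  .mk' (centerLinearPart n) fun f g => congrArg Prod.snd
    (stabilizerCoord_mul (isAdapted_centerCoordinates (n := n)) f g)

theorem coe_linearization (f : centerStabilizer A) :
    (linearization n A f : CenterTangent n A →L[ℝ] CenterTangent n A) =
      differentialAtCenter n f :=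
  (differentialAtCenter_eq f).symm

/-- Smoothness into the open set of units can be tested on the underlying operators, where the map
is a linear projection read in the stabilizer chart. -/
theorem contMDiff_linearization :
    ContMDiff 𝓘(ℝ, StabilizerModel n) 𝓘(ℝ, CenterTangent n A →L[ℝ] CenterTangent n A) ∞
      (linearization n A) :=
  ContMDiff.of_comp_isOpenEmbedding Units.isOpenEmbedding_val
    (contDiff_snd.contMDiff.comp
      (contMDiff_stabilizerChart (isAdapted_centerCoordinates (n := n) (A := A))))

/-- The section `T ↦ (0, T)` of the linearizing map. -/
def linearizationSection (T : (CenterTangent n A →L[ℝ] CenterTangent n A)ˣ) : centerStabilizer A :=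
  (stabilizerCoord (isAdapted_centerCoordinates (n := n))).symm (0, T)

theorem linearization_section (T : (CenterTangent n A →L[ℝ] CenterTangent n A)ˣ) :
    linearization n A (linearizationSection T) = T :=
  congrArg Prod.snd ((stabilizerCoord isAdapted_centerCoordinates).apply_symm_apply (0, T))

theorem contMDiff_linearizationSection :
    ContMDiff 𝓘(ℝ, CenterTangent n A →L[ℝ] CenterTangent n A) 𝓘(ℝ, StabilizerModel n) ∞
      (linearizationSection (n := n) (A := A)) := by
  have hφ := isAdapted_centerCoordinates (n := n) (A := A)
  refine contMDiff_of_stabilizerChart_comp hφ ?_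
  have h : ContDiff ℝ ∞ fun T : E n →L[ℝ] E n => ((0, T) : StabilizerModel n) :=
    contDiff_const.prodMk contDiff_id
  refine (h.contMDiff.comp (Units.contMDiff_val (𝕜 := ℝ)
    (R := CenterTangent n A →L[ℝ] CenterTangent n A))).congr fun T => ?_
  rw [stabilizerChart_apply]
  have := (stabilizerCoord hφ).apply_symm_apply (0, T)
  exact congrArg (fun p => ((p.1, (p.2 : E n →L[ℝ] E n)) : StabilizerModel n)) this

end Differential

/-! ### The quotient Lie group. -/

section QuotientGroup

variable {W : Type*} [NormedAddCommGroup W] [NormedSpace ℝ W] {n : ℕ}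
  [Fact (Module.finrank ℝ W = n + 1)] {A : ℙ ℝ W}

/-- The isomorphism `fH ↦ d_A f` induced by the linearizing map. -/
def linearizationEquiv (n : ℕ) [Fact (Module.finrank ℝ W = n + 1)] (A : ℙ ℝ W) :
    (centerStabilizer A ⧸ (linearization n A).ker) ≃*
      (CenterTangent n A →L[ℝ] CenterTangent n A)ˣ :=
  QuotientGroup.quotientKerEquivOfRightInverse (linearization n A) linearizationSection
    linearization_section

/-- The induced map is continuous by the quotient topology, and its inverse is continuous as the
projection composed with the section. The units are open among the operators. -/
theorem isOpenEmbedding_linearizationEquiv :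
    Topology.IsOpenEmbedding fun x : centerStabilizer A ⧸ (linearization n A).ker =>
      (linearizationEquiv n A x : CenterTangent n A →L[ℝ] CenterTangent n A) := by
  let e : (centerStabilizer A ⧸ (linearization n A).ker) ≃ₜ
      (CenterTangent n A →L[ℝ] CenterTangent n A)ˣ :=
    { (linearizationEquiv n A).toEquiv with
      continuous_toFun := isQuotientMap_quot_mk.continuous_iff.2
        contMDiff_linearization.continuous
      continuous_invFun := QuotientGroup.continuous_mk.comp
        contMDiff_linearizationSection.continuous }
  exact Units.isOpenEmbedding_val.comp e.isOpenEmbedding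

/-- The smooth structure of the quotient of the stabilizer by the kernel of the linearizing map,
given by the single chart `fH ↦ d_A f`. -/
abbrev quotientChartedSpace (n : ℕ) [Fact (Module.finrank ℝ W = n + 1)] (A : ℙ ℝ W) :
    ChartedSpace (CenterTangent n A →L[ℝ] CenterTangent n A)
      (centerStabilizer A ⧸ (linearization n A).ker) :=
  isOpenEmbedding_linearizationEquiv.singletonChartedSpace

theorem isQuotientLieGroup_quotientChartedSpace :
    IsQuotientLieGroup (StabilizerModel n) (linearization n A).ker (quotientChartedSpace n A) := by
  let _ := quotientChartedSpace n A
  have hemb := isOpenEmbedding_linearizationEquiv (n := n) (A := A)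
  have : IsManifold 𝓘(ℝ, CenterTangent n A →L[ℝ] CenterTangent n A) ∞
      (centerStabilizer A ⧸ (linearization n A).ker) := hemb.isManifold_singleton
  have hΦ : ContMDiff 𝓘(ℝ, CenterTangent n A →L[ℝ] CenterTangent n A)
      𝓘(ℝ, CenterTangent n A →L[ℝ] CenterTangent n A) ∞ (linearizationEquiv n A) :=
    ContMDiff.of_comp_isOpenEmbedding Units.isOpenEmbedding_val (contMDiff_isOpenEmbedding hemb)
  refine ⟨{ contMDiff_mul := ?_, contMDiff_inv := ?_ }, ?_⟩
  · refine ContMDiff.of_comp_isOpenEmbedding hemb ?_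
    refine (Units.contMDiff_val.comp
      ((hΦ.comp contMDiff_fst).mul (hΦ.comp contMDiff_snd))).congr fun x => ?_
    simp
  · refine ContMDiff.of_comp_isOpenEmbedding hemb ?_
    refine (Units.contMDiff_val.comp hΦ.inv).congr fun x => ?_
    simp
  · have hφ := isAdapted_centerCoordinates (n := n) (A := A)
    refine ⟨E n →L[ℝ] ℝ, inferInstance, inferInstance, fun f => ?_⟩
    -- In these charts the projection is $(\alpha,T)\mapsto T$. The swap puts $T$ first, as the
    -- normal form of a submersion requires, and leaves the linear forms $\alpha$ as the complement.
    refine .mk_of_charts (ContinuousLinearEquiv.prodComm ℝ (E n →L[ℝ] ℝ) (E n →L[ℝ] E n))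
      (stabilizerChart hφ) (chartAt _ (QuotientGroup.mk f)) (Set.mem_univ _)
      (mem_chart_source _ _) (stabilizerChart_mem_maximalAtlas hφ)
      (IsManifold.chart_mem_maximalAtlas _) (fun _ _ => Set.mem_univ _) fun p hp => ?_
    have hp' : p ∈ (stabilizerChart hφ).target := by simpa using hp
    exact congrArg Prod.snd ((stabilizerChart hφ).right_inv hp')

end QuotientGroup

end CenteredProjective

end

theorem mainTheorem5 (n : ℕ) {W : Type*} [NormedAddCommGroup W] [NormedSpace ℝ W]
    [Fact (Module.finrank ℝ W = n + 1)] (A : ℙ ℝ W) :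
    IsManifold (𝓡 n) ∞ (ℙ ℝ W) ∧
    LieGroup 𝓘(ℝ, StabilizerModel n) ∞ (centerStabilizer A) ∧
    ∃ β : centerStabilizer A →* (CenterTangent n A →L[ℝ] CenterTangent n A)ˣ,
      (∀ f : centerStabilizer A, MDifferentiableAt (𝓡 n) (𝓡 n) (fun p : ℙ ℝ W => f • p) A ∧
        (β f : CenterTangent n A →L[ℝ] CenterTangent n A) = differentialAtCenter n f) ∧
      ContMDiff 𝓘(ℝ, StabilizerModel n)
        𝓘(ℝ, CenterTangent n A →L[ℝ] CenterTangent n A) ∞ β ∧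
      Function.Surjective β ∧
      IsClosed (β.ker : Set (centerStabilizer A)) ∧ β.ker.Normal ∧
      ∃ Φ : (centerStabilizer A ⧸ β.ker) ≃* (CenterTangent n A →L[ℝ] CenterTangent n A)ˣ,
        (∀ f : centerStabilizer A,
          (Φ (QuotientGroup.mk f) : CenterTangent n A →L[ℝ] CenterTangent n A) =
            differentialAtCenter n f) ∧
        (∃ cs : ChartedSpace (CenterTangent n A →L[ℝ] CenterTangent n A)
          (centerStabilizer A ⧸ β.ker), IsQuotientLieGroup (StabilizerModel n) β.ker cs) ∧
        ∀ (F : Type) [NormedAddCommGroup F] [NormedSpace ℝ F]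
          (cs : ChartedSpace F (centerStabilizer A ⧸ β.ker)), IsQuotientLieGroup (StabilizerModel n) β.ker cs →
          ContMDiff 𝓘(ℝ, F) 𝓘(ℝ, CenterTangent n A →L[ℝ] CenterTangent n A) ∞ Φ ∧
          ContMDiff 𝓘(ℝ, CenterTangent n A →L[ℝ] CenterTangent n A) 𝓘(ℝ, F) ∞ Φ.symm := by
  refine ⟨inferInstance, inferInstance, linearization n A,
    fun f => ⟨(hasMFDerivAt_smul f).mdifferentiableAt, coe_linearization f⟩,
    contMDiff_linearization, fun T => ⟨linearizationSection T, linearization_section T⟩,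
    ?_, inferInstance, linearizationEquiv n A, coe_linearization,
    ⟨quotientChartedSpace n A, isQuotientLieGroup_quotientChartedSpace⟩, ?_⟩
  · exact isClosed_singleton.preimage (contMDiff_linearization (n := n) (A := A)).continuous
  · intro F _ _ cs hcs
    -- The submersion property is needed only for $\bar\beta$. For the inverse, smoothness of the
    -- projection and of the global section is enough.
    exact ⟨contMDiff_of_comp_isSubmersion hcs.2 QuotientGroup.mk_surjective contMDiff_linearization,
      hcs.2.contMDiff.comp contMDiff_linearizationSection⟩
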